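/- Let $X$ be a nonzero real Banach space, let $C \subset X$ be a bounded closed convex set and let $f : C \to \mathbb{R}$ be uniformly continuous. For $\varepsilon>0$ and $D \subset C$ put $$[D]'_\varepsilon = \{x \in D : \operatorname{diam} f(D \cap H) > \varepsilon \text{ for every open halfspace } H \text{ of } X \text{ with } x \in H\},$$ where an open halfspace is a set $\{x \in X: x^*(x)>a\}$ with $x^* \in X^*\setminus\{0\}$ and $a\in\mathbb{R}$. Put $[C]^0_\varepsilon = C$ and $[C]^{n}_\varepsilon = [[C]^{n-1}_\varepsilon]'_\varepsilon$ for $n\ge 1$. Let $\operatorname{Dz}(f,\varepsilon)$ be the least $n$ with $[C]^n_\varepsilon=\emptyset$, and write $\operatorname{Dz}(f,\varepsilon)<\omega$ if such an $n$ exists. A function $g : C \to \mathbb{R}$ is called $\mathcal{DC}$-Lipschitz if it is the difference of two convex Lipschitz functions on $C$, and $\|h\|_C=\sup_{x\in C}|h(x)|$. Let - $\varepsilon_1$ be the infimum of the $\varepsilon>0$ such that $\operatorname{Dz}(f,\varepsilon)<\omega$; - $\varepsilon_2$ be the infimum of the $\varepsilon>0$ such that there is a $\mathcal{DC}$-Lipschitz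 function $g:C\to\mathbb{R}$ with $\|f-g\|_C<\varepsilon$. Then both infima are taken over nonempty sets (so $\varepsilon_1,\varepsilon_2$ are finite), and $$\frac{\varepsilon_1}{2} \le \varepsilon_2 \le 2\varepsilon_1 .$$ -/

import Mathlib

open scoped ENNReal NNReal

/-- Open halfspaces of a real normed space `X`: the sets `{x | a < φ x}` with `φ` a nonzero
continuous linear functional and `a` a real number. -/
def IsOpenHalfspace {X : Type*} [NormedAddCommGroup X] [NormedSpace ℝ X] (H : Set X) : Prop :=
  ∃ (φ : X →L[ℝ] ℝ) (a : ℝ), φ ≠ 0 ∧ H = {x | a < φ x}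

/-- The set derivation `[D]'_ε` through the map `F`: the points `x` of `D` such that
`diam (F (D ∩ H)) > ε` for every open halfspace `H` containing `x`. The map `F` is a total
function, but only its values on `D` matter. The diameter is `[0, ∞]`-valued. -/
def dentDeriv {X M : Type*} [NormedAddCommGroup X] [NormedSpace ℝ X] [PseudoMetricSpace M]
    (F : X → M) (ε : ℝ) (D : Set X) : Set X :=
  {x | x ∈ D ∧ ∀ H : Set X, IsOpenHalfspace H → x ∈ H →
    ENNReal.ofReal ε < Metric.ediam (F '' (D ∩ H))}

/-- The iterated derived sets: `[C]^0_ε = C` and `[C]^(n+1)_ε = [[C]^n_ε]'_ε`. -/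
def dentIter {X M : Type*} [NormedAddCommGroup X] [NormedSpace ℝ X] [PseudoMetricSpace M]
    (F : X → M) (ε : ℝ) (C : Set X) : ℕ → Set X
  | 0 => C
  | n + 1 => dentDeriv F ε (dentIter F ε C n)

/-- The dentability index `Dz(F, ε)` of `F` on `C`: the least `n` with `[C]^n_ε = ∅`, and
`⊤` (playing the role of `ω`) if there is none. -/
noncomputable def Dz {X M : Type*} [NormedAddCommGroup X] [NormedSpace ℝ X]
    [PseudoMetricSpace M] (C : Set X) (F : X → M) (ε : ℝ) : ℕ∞ :=
  ⨅ (n : ℕ) (_ : dentIter F ε C n = ∅), (n : ℕ∞)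

/-- `g` is `DC`-Lipschitz on `C`: on `C` it is the difference of two convex Lipschitz
functions with domain `C`. -/
def IsDCLipschitzOn {X : Type*} [NormedAddCommGroup X] [NormedSpace ℝ X]
    (C : Set X) (g : X → ℝ) : Prop :=
  ∃ u v : X → ℝ, ConvexOn ℝ C u ∧ ConvexOn ℝ C v ∧
    (∃ K : ℝ≥0, LipschitzOnWith K u C) ∧ (∃ K : ℝ≥0, LipschitzOnWith K v C) ∧
    ∀ x ∈ C, g x = u x - v x

/-- The supremum norm on `C`, with values in `[0, ∞]`. -/
noncomputable def supNormOn {X : Type*} (C : Set X) (h : X → ℝ) : ℝ≥0∞ :=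
  ⨆ x ∈ C, ‖h x‖ₑ

/-- The numbers `ε > 0` such that `Dz(f, ε) < ω`. -/
def dentableEps {X : Type*} [NormedAddCommGroup X] [NormedSpace ℝ X]
    (C : Set X) (f : X → ℝ) : Set ℝ :=
  {ε | 0 < ε ∧ Dz C f ε < ⊤}

/-- The numbers `ε > 0` such that `‖f - g‖_C < ε` for some `DC`-Lipschitz function `g`. -/
def dcApproxEps {X : Type*} [NormedAddCommGroup X] [NormedSpace ℝ X]
    (C : Set X) (f : X → ℝ) : Set ℝ :=
  {ε | 0 < ε ∧ ∃ g : X → ℝ, IsDCLipschitzOn C g ∧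
    supNormOn C (fun x => f x - g x) < ENNReal.ofReal ε}

/-! Both inequalities trade derivations for convexity. If `f` is `r`-close to `u - v` with `u`, `v`
convex, shift both to be nonnegative. Each derivation at scale `2 * r + ε` lowers the bound on `u ^
2 + v ^ 2` by `ε ^ 2 / 8` (`sq_add_sq_le_of_mem_dentDeriv`), so the process stops and `ε₁ ≤ 2 * ε₂`.
Conversely, let the derived sets at scale `ε` die out, and let `h` be the sum of their distance
functions and the squares of these. A small midpoint defect of `h` at `x`, `y` makes every distance
nearly equal at `x` and `y` and nearly affine between them. A suitable derived set then has points
near `x` and near `y` whose segment misses the next one, and connectedness gives `|f x - f y| ≤ 2 *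
ε` up to a small error (`abs_sub_le_of_infDist_dentIter`). Penalising `f` by a large multiple of the
defect gives the approximant (`exists_isDCLipschitzOn_of_midpoint`). -/

/-! ### Boundedness and separation by halfspaces. -/

section Halfspaces

variable {X : Type*} [NormedAddCommGroup X] [NormedSpace ℝ X]

/-- On bounded convex sets, uniformly continuous real functions are bounded. -/
lemma UniformContinuousOn.exists_abs_le_of_isBounded_of_convex {C : Set X} {f : X → ℝ}
    (hf : UniformContinuousOn f C) (hbdd : Bornology.IsBounded C) (hconv : Convex ℝ C) :
    ∃ M, ∀ x ∈ C, |f x| ≤ M := by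
  rcases C.eq_empty_or_nonempty with rfl | ⟨x, hx⟩
  · exact ⟨0, by simp⟩
  obtain ⟨δ, hδ, hf⟩ := Metric.uniformContinuousOn_iff.1 hf 1 one_pos
  obtain ⟨R, hR⟩ := Metric.isBounded_iff.1 hbdd
  -- Cut the segment into `n` pieces shorter than `δ`, so `f` moves by less than 1 on each; the
  -- `max` keeps `n` positive.
  obtain ⟨n, hn⟩ := exists_nat_gt (max 1 (R / δ))
  have hn0 : (0 : ℝ) < n := lt_trans one_pos ((le_max_left _ _).trans_lt hn)
  have hRn : R < δ * n := by
    have := (le_max_right _ _).trans_lt hn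
    rwa [div_lt_iff₀ hδ, mul_comm] at this
  refine ⟨|f x| + n, fun y hy => ?_⟩
  have hmem : ∀ i : ℕ, i ≤ n → x + ((i : ℝ) / n) • (y - x) ∈ C := fun i hi =>
    hconv.add_smul_sub_mem hx hy ⟨by positivity, (div_le_one hn0).2 (by exact_mod_cast hi)⟩
  have key : ∀ i : ℕ, i ≤ n → |f (x + ((i : ℝ) / n) • (y - x))| ≤ |f x| + i := by
    intro i
    induction i with
    | zero => simp
    | succ i ih =>
      intro hi
      have h1 := ih (by omega)
      have h2 := hf _ (hmem (i + 1) hi) _ (hmem i (by omega)) (by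
        have h3 : x + (((i + 1 : ℕ) : ℝ) / n) • (y - x) - (x + ((i : ℝ) / n) • (y - x))
            = (1 / (n : ℝ)) • (y - x) := by
          rw [add_sub_add_left_eq_sub, ← sub_smul]
          congr 1
          push_cast
          ring
        rw [dist_eq_norm, h3, norm_smul, Real.norm_of_nonneg (by positivity), ← dist_eq_norm,
          one_div, inv_mul_lt_iff₀ hn0]
        linarith [hR hy hx, mul_comm δ n])
      rw [Real.dist_eq] at h2
      have h4 := abs_sub_abs_le_abs_sub (f (x + (((i + 1 : ℕ) : ℝ) / n) • (y - x)))
        (f (x + ((i : ℝ) / n) • (y - x)))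
      push_cast at *
      linarith
  simpa [div_self hn0.ne'] using key n le_rfl

lemma IsOpenHalfspace.isOpen {H : Set X} (hH : IsOpenHalfspace H) : IsOpen H := by
  obtain ⟨φ, a, -, rfl⟩ := hH
  exact isOpen_lt continuous_const φ.continuous

/-- Halfspaces have convex complements. -/
lemma IsOpenHalfspace.mem_or_mem_of_mem_segment {H : Set X} (hH : IsOpenHalfspace H) {x y z : X}
    (hz : z ∈ segment ℝ x y) (hzH : z ∈ H) : x ∈ H ∨ y ∈ H := by
  obtain ⟨φ, a, -, rfl⟩ := hH
  have hc : Convex ℝ {w | φ w ≤ a} := convex_halfSpace_le φ.toLinearMap.isLinear a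
  by_contra! h
  simp only [Set.mem_ofPred_eq, not_lt] at h hzH
  exact absurd (hc.segment_subset h.1 h.2 hz) (not_le.2 hzH)

/-- A point outside a closed convex set lies in an open halfspace missing that set. -/
lemma exists_isOpenHalfspace_of_notMem [Nontrivial X] {K : Set X} (hK : Convex ℝ K)
    (hKc : IsClosed K) {x : X} (hx : x ∉ K) :
    ∃ H, IsOpenHalfspace H ∧ x ∈ H ∧ Disjoint H K := by
  -- Only a point of `K` forces the separating functional to be nonzero, so empty `K` needs a
  -- functional supplied by hand.
  rcases K.eq_empty_or_nonempty with rfl | ⟨y, hy⟩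
  · obtain ⟨w, hw⟩ := exists_ne (0 : X)
    obtain ⟨φ, hφ⟩ := SeparatingDual.exists_ne_zero (R := ℝ) hw
    refine ⟨{z | φ x - 1 < φ z}, ⟨φ, _, fun h => hφ (by simp [h]), rfl⟩, by simp, by simp⟩
  · obtain ⟨φ, a, h1, h2⟩ := geometric_hahn_banach_closed_point hK hKc hx
    refine ⟨{z | a < φ z}, ⟨φ, a, ?_, rfl⟩, h2, Set.disjoint_left.2 fun z hz hzK => ?_⟩
    · rintro rfl
      have := h1 y hy
      simp at this h2
      linarith
    · exact absurd (h1 z hzK) (not_lt.2 (le_of_lt hz))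

end Halfspaces

/-! ### Derived sets: convexity and connectedness. -/

section Derivation

variable {X : Type*} [NormedAddCommGroup X] [NormedSpace ℝ X] {f : X → ℝ} {ε : ℝ} {D : Set X}

lemma dentDeriv_subset : dentDeriv f ε D ⊆ D := fun _ hx => hx.1

lemma dentIter_subset (C : Set X) (n : ℕ) : dentIter f ε C n ⊆ C := by
  induction n with
  | zero => exact subset_rfl
  | succ n ih => exact dentDeriv_subset.trans ih

lemma ofReal_lt_ediam_image_iff {ι : Type*} {f : ι → ℝ} (hε : 0 ≤ ε) {s : Set ι} :
    ENNReal.ofReal ε < Metric.ediam (f '' s) ↔ ∃ y ∈ s, ∃ z ∈ s, ε < |f y - f z| := by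
  rw [← not_iff_not]
  push Not
  rw [Metric.ediam_image_le_iff]
  refine forall₄_congr fun y _ z _ => ?_
  rw [edist_dist, ENNReal.ofReal_le_ofReal_iff hε, Real.dist_eq]

/-- A point of `D` is not in the derived set iff some halfspace cuts out of `D` a slice around
it on which `f` oscillates by at most `ε`. -/
lemma notMem_dentDeriv_iff (hε : 0 ≤ ε) {x : X} (hx : x ∈ D) :
    x ∉ dentDeriv f ε D ↔ ∃ H, IsOpenHalfspace H ∧ x ∈ H ∧
      ∀ y ∈ D ∩ H, ∀ z ∈ D ∩ H, |f y - f z| ≤ ε := by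
  simp only [dentDeriv, Set.mem_ofPred_eq, hx, true_and, ofReal_lt_ediam_image_iff hε]
  push Not
  rfl

/-- Derivation deletes whole open slices, so what remains is cut out of `D` by closed halfspaces;
this is why convexity is preserved. -/
lemma dentDeriv_eq_diff : dentDeriv f ε D =
    D ∩ ⋂ H ∈ {H : Set X | IsOpenHalfspace H ∧ Metric.ediam (f '' (D ∩ H)) ≤ ENNReal.ofReal ε},
      Hᶜ := by
  ext x
  simp only [dentDeriv, Set.mem_ofPred_eq, Set.mem_inter_iff, Set.mem_iInter, Set.mem_compl_iff,
    and_congr_right_iff]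
  intro _
  refine forall_congr' fun H => ?_
  rw [← not_lt]
  tauto

lemma Convex.dentDeriv (hD : Convex ℝ D) : Convex ℝ (dentDeriv f ε D) := by
  rw [dentDeriv_eq_diff]
  refine hD.inter (convex_iInter₂ fun H hH => ?_)
  obtain ⟨φ, a, -, rfl⟩ := hH.1
  have : {x | a < φ x}ᶜ = {x | φ x ≤ a} := by ext; simp
  rw [this]
  exact convex_halfSpace_le φ.toLinearMap.isLinear a

lemma Convex.dentIter {C : Set X} (hC : Convex ℝ C) (n : ℕ) : Convex ℝ (dentIter f ε C n) := by
  induction n with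
  | zero => exact hC
  | succ n ih => exact ih.dentDeriv

lemma Dz_lt_top_iff {C : Set X} : Dz C f ε < ⊤ ↔ ∃ n, dentIter f ε C n = ∅ := by
  simp [Dz, iInf_lt_iff]

/-- If the segment between two points of `D` avoids the derived set, then the values at the
end points differ by at most `2 * ε`. -/
lemma abs_sub_le_of_disjoint_dentDeriv (hε : 0 ≤ ε) (hD : Convex ℝ D) {x y : X} (hx : x ∈ D)
    (hy : y ∈ D) (h : Disjoint (segment ℝ x y) (dentDeriv f ε D)) : |f x - f y| ≤ 2 * ε := by
  -- `U w` is the union of the small-oscillation halfspaces through `w`. The open sets `U x` and `U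
  -- y` cover the segment, so they share a point of it.
  let U : X → Set X := fun w =>
    ⋃₀ {H | IsOpenHalfspace H ∧ w ∈ H ∧ ∀ y ∈ D ∩ H, ∀ z ∈ D ∩ H, |f y - f z| ≤ ε}
  have hU : ∀ w, IsOpen (U w) := fun w => isOpen_sUnion fun H hH => hH.1.isOpen
  have hcov : ∀ z ∈ segment ℝ x y, z ∈ U x ∪ U y := by
    intro z hz
    obtain ⟨H, hH, hzH, hosc⟩ := (notMem_dentDeriv_iff hε (hD.segment_subset hx hy hz)).1
      (Set.disjoint_left.1 h hz)
    exact (hH.mem_or_mem_of_mem_segment hz hzH).imp (fun h => ⟨H, ⟨hH, h, hosc⟩, hzH⟩)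
      fun h => ⟨H, ⟨hH, h, hosc⟩, hzH⟩
  have hself : ∀ w ∈ segment ℝ x y, w ∈ U w := by
    intro w hw
    obtain ⟨H, hH, hzH, hosc⟩ := (notMem_dentDeriv_iff hε (hD.segment_subset hx hy hw)).1
      (Set.disjoint_left.1 h hw)
    exact ⟨H, ⟨hH, hzH, hosc⟩, hzH⟩
  obtain ⟨z, hz, ⟨H, hH, hzH⟩, ⟨H', hH', hzH'⟩⟩ :=
    (convex_segment x y).isPreconnected (U x) (U y) (hU x) (hU y) hcov
      ⟨x, left_mem_segment ℝ x y, hself x (left_mem_segment ℝ x y)⟩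
      ⟨y, right_mem_segment ℝ x y, hself y (right_mem_segment ℝ x y)⟩
  have hzD := hD.segment_subset hx hy hz
  have h1 := hH.2.2 x ⟨hx, hH.2.1⟩ z ⟨hzD, hzH⟩
  have h2 := hH'.2.2 z ⟨hzD, hzH'⟩ y ⟨hy, hH'.2.1⟩
  linarith [abs_sub_le (f x) (f z) (f y)]

end Derivation

/-! ### From DC approximation to finite index. -/

section Dentable

variable {X : Type*} [NormedAddCommGroup X] [NormedSpace ℝ X] [Nontrivial X]

/-- If `f` is `r`-close to a difference of nonnegative convex functions `u`, `v`, then a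
derivation lowers the supremum of `u ^ 2 + v ^ 2` by a fixed amount. -/
lemma sq_add_sq_le_of_mem_dentDeriv {C D : Set X} {f u v : X → ℝ} {r ε s : ℝ}
    (hC : IsClosed C) (hu : ConvexOn ℝ C u) (hv : ConvexOn ℝ C v) (huc : ContinuousOn u C)
    (hvc : ContinuousOn v C) (hu0 : ∀ x ∈ C, 0 ≤ u x) (hv0 : ∀ x ∈ C, 0 ≤ v x)
    (hr : 0 ≤ r) (hε : 0 < ε) (hf : ∀ x ∈ C, |f x - (u x - v x)| ≤ r) (hDC : D ⊆ C)
    (hs : ∀ x ∈ D, u x ^ 2 + v x ^ 2 ≤ s) {x : X} (hx : x ∈ dentDeriv f (2 * r + ε) D) :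
    u x ^ 2 + v x ^ 2 ≤ s - ε ^ 2 / 8 := by
  by_contra! hlt
  have hxD : x ∈ D := hx.1
  have hxC : x ∈ C := hDC hxD
  -- The cross term in `(u y - u x) ^ 2 + (v y - v x) ^ 2`. It is convex in `y` because `u x` and `v
  -- x` are nonnegative; where `l y > c` and `y ∈ D`, that sum is below `ε ^ 2 / 8`.
  let l : X → ℝ := fun y => 2 * u x * u y + 2 * v x * v y
  have hl : ConvexOn ℝ C l :=
    (hu.smul (mul_nonneg zero_le_two (hu0 x hxC))).add
      (hv.smul (mul_nonneg zero_le_two (hv0 x hxC)))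
  have hlc : ContinuousOn l C := by fun_prop
  let c := s + u x ^ 2 + v x ^ 2 - ε ^ 2 / 8
  have hK : IsClosed {y ∈ C | l y ≤ c} := hlc.preimage_isClosed_of_isClosed hC isClosed_Iic
  obtain ⟨H, hH, hxH, hdisj⟩ := exists_isOpenHalfspace_of_notMem (hl.convex_le c) hK
    (x := x) (fun h => by have := h.2; simp only [l, c] at this; linarith)
  refine (notMem_dentDeriv_iff (by positivity) hxD).2 ⟨H, hH, hxH, ?_⟩ hx
  have hosc : ∀ y ∈ D ∩ H, |u y - v y - (u x - v x)| ≤ ε / 2 := by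
    intro y hy
    by_contra! hgt
    refine Set.disjoint_left.1 hdisj hy.2 ⟨hDC hy.1, ?_⟩
    have h1 := hs y hy.1
    have h2 : (ε / 2) ^ 2 ≤ (u y - v y - (u x - v x)) ^ 2 := by
      rw [← sq_abs (u y - v y - (u x - v x))]
      gcongr
    simp only [l, c]
    nlinarith [sq_nonneg ((u y - u x) + (v y - v x))]
  intro y hy z hz
  have h1 := abs_le.1 (hosc y hy)
  have h2 := abs_le.1 (hosc z hz)
  have h3 := abs_le.1 (hf y (hDC hy.1))
  have h4 := abs_le.1 (hf z (hDC hz.1))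
  exact abs_le.2 ⟨by linarith, by linarith⟩

lemma Dz_lt_top_of_close_isDCLipschitzOn {C : Set X} (hbdd : Bornology.IsBounded C)
    (hclosed : IsClosed C) (hconv : Convex ℝ C) {f g : X → ℝ} {r ε : ℝ} (hr : 0 ≤ r)
    (hε : 0 < ε) (hg : IsDCLipschitzOn C g) (hfg : ∀ x ∈ C, |f x - g x| ≤ r) :
    Dz C f (2 * r + ε) < ⊤ := by
  obtain ⟨u, v, hu, hv, ⟨K, hK⟩, ⟨L, hL⟩, huv⟩ := hg
  obtain ⟨M, hM⟩ := hK.uniformContinuousOn.exists_abs_le_of_isBounded_of_convex hbdd hconv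
  obtain ⟨N, hN⟩ := hL.uniformContinuousOn.exists_abs_le_of_isBounded_of_convex hbdd hconv
  -- Adding `B` to both `u` and `v` makes them nonnegative without changing `u - v`; the values then
  -- lie in `[0, 2 * B]`, whence `8 * B ^ 2`.
  let B := |M| + |N|
  have huB : ∀ x ∈ C, |u x| ≤ B := fun x hx =>
    ((hM x hx).trans (le_abs_self M)).trans (le_add_of_nonneg_right (abs_nonneg N))
  have hvB : ∀ x ∈ C, |v x| ≤ B := fun x hx =>
    ((hN x hx).trans (le_abs_self N)).trans (le_add_of_nonneg_left (abs_nonneg M))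
  have key : ∀ n : ℕ, ∀ x ∈ dentIter f (2 * r + ε) C n,
      (u x + B) ^ 2 + (v x + B) ^ 2 ≤ 8 * B ^ 2 - n * (ε ^ 2 / 8) := by
    intro n
    induction n with
    | zero =>
      intro x hx
      have h1 := abs_le.1 (huB x hx)
      have h2 := abs_le.1 (hvB x hx)
      push_cast
      nlinarith
    | succ n ih =>
      intro x hx
      have := sq_add_sq_le_of_mem_dentDeriv (u := fun x => u x + B) (v := fun x => v x + B)
        hclosed (hu.add_const B) (hv.add_const B) (hK.continuousOn.add continuousOn_const)
        (hL.continuousOn.add continuousOn_const)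
        (fun x hx => by linarith [(abs_le.1 (huB x hx)).1])
        (fun x hx => by linarith [(abs_le.1 (hvB x hx)).1]) hr hε
        (fun x hx => by simpa [huv x hx] using hfg x hx) (dentIter_subset C n) ih hx
      push_cast
      linarith
  obtain ⟨n, hn⟩ := exists_nat_gt (8 * B ^ 2 / (ε ^ 2 / 8))
  rw [div_lt_iff₀ (by positivity)] at hn
  refine Dz_lt_top_iff.2 ⟨n, Set.eq_empty_of_forall_notMem fun x hx => ?_⟩
  have := key n x hx
  nlinarith [sq_nonneg (u x + B), sq_nonneg (v x + B)]

end Dentable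

/-! ### Convexity tools and regularisation by a midpoint defect. -/

section Approximation

variable {X : Type*} [NormedAddCommGroup X] [NormedSpace ℝ X]

lemma Convex.convexOn_infDist {D C : Set X} (hD : Convex ℝ D) (hC : Convex ℝ C) :
    ConvexOn ℝ C fun x => Metric.infDist x D := by
  refine ⟨hC, fun x _ y _ a b ha hb hab => ?_⟩
  rcases D.eq_empty_or_nonempty with rfl | hne
  · simp
  refine le_of_forall_pos_le_add fun η hη => ?_
  obtain ⟨x', hx', hxx'⟩ := (Metric.infDist_lt_iff hne).1
    (lt_add_of_pos_right (Metric.infDist x D) hη)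
  obtain ⟨y', hy', hyy'⟩ := (Metric.infDist_lt_iff hne).1
    (lt_add_of_pos_right (Metric.infDist y D) hη)
  have h1 := Metric.infDist_le_dist_of_mem (x := a • x + b • y) (hD hx' hy' ha hb hab)
  have h2 : dist (a • x + b • y) (a • x' + b • y') ≤ a * dist x x' + b * dist y y' := by
    refine (dist_add_add_le _ _ _ _).trans_eq ?_
    rw [dist_smul₀, dist_smul₀, Real.norm_of_nonneg ha, Real.norm_of_nonneg hb]
  simp only [smul_eq_mul]
  have h3 := mul_le_mul_of_nonneg_left hxx'.le ha
  have h4 := mul_le_mul_of_nonneg_left hyy'.le hb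
  have h5 : a * η + b * η = η := by rw [← add_mul, hab, one_mul]
  linarith

lemma LipschitzOnWith.exists_sq {Y : Type*} [PseudoMetricSpace Y] {C : Set Y} {u : Y → ℝ}
    {K : ℝ≥0} (hu : LipschitzOnWith K u C)
    {M : ℝ} (hM : ∀ x ∈ C, |u x| ≤ M) : ∃ L, LipschitzOnWith L (fun x => u x ^ 2) C := by
  refine ⟨(2 * |M| * K).toNNReal, LipschitzOnWith.of_le_add_mul' _ fun x hx y hy => ?_⟩
  have h1 := hu.dist_le_mul x hx y hy
  rw [Real.dist_eq] at h1
  have h2 : |u x + u y| ≤ 2 * |M| := by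
    linarith [abs_add_le (u x) (u y), hM x hx, hM y hy, le_abs_self M]
  have h3 : u x ^ 2 - u y ^ 2 ≤ |u x + u y| * |u x - u y| := by
    rw [← abs_mul, sq_sub_sq]
    exact le_abs_self _
  have h4 := mul_le_mul h2 h1 (abs_nonneg _) (by positivity)
  linarith

lemma LipschitzOnWith.exists_sum {Y ι : Type*} [PseudoMetricSpace Y] {C : Set Y}
    {u : ι → Y → ℝ} (s : Finset ι)
    (hu : ∀ i ∈ s, ∃ K, LipschitzOnWith K (u i) C) :
    ∃ K, LipschitzOnWith K (fun x => ∑ i ∈ s, u i x) C := by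
  classical
  induction s using Finset.induction_on with
  | empty => exact ⟨0, by simp⟩
  | insert i s hi ih =>
    obtain ⟨K, hK⟩ := hu i (Finset.mem_insert_self i s)
    obtain ⟨L, hL⟩ := ih fun j hj => hu j (Finset.mem_insert_of_mem hj)
    refine ⟨K + L, ?_⟩
    simp only [Finset.sum_insert hi]
    exact hK.add hL

lemma ConvexOn.finset_sum {ι : Type*} {C : Set X} {u : ι → X → ℝ} (hC : Convex ℝ C)
    (s : Finset ι) (hu : ∀ i ∈ s, ConvexOn ℝ C (u i)) :
    ConvexOn ℝ C fun x => ∑ i ∈ s, u i x := by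
  classical
  induction s using Finset.induction_on with
  | empty => simpa using convexOn_const (0 : ℝ) hC
  | insert i s hi ih =>
    simp only [Finset.sum_insert hi]
    exact (hu i (Finset.mem_insert_self i s)).add
      (ih fun j hj => hu j (Finset.mem_insert_of_mem hj))

lemma ConvexOn.midpoint_le {C : Set X} {u : X → ℝ} (hu : ConvexOn ℝ C u) {x y : X} (hx : x ∈ C)
    (hy : y ∈ C) : 2 * u ((1 / 2 : ℝ) • x + (1 / 2 : ℝ) • y) ≤ u x + u y := by
  have := hu.2 hx hy (by norm_num : (0 : ℝ) ≤ 1 / 2) (by norm_num : (0 : ℝ) ≤ 1 / 2)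
    (by norm_num)
  simp only [smul_eq_mul] at this
  linarith

/-- A convex function which is nearly midpoint affine for the end points of a segment is nearly
affine on the segment. -/
lemma ConvexOn.le_of_midpoint {C : Set X} {u : X → ℝ} (hu : ConvexOn ℝ C u)
    {x y : X} (hx : x ∈ C) (hy : y ∈ C) {ρ : ℝ} (hρ : 0 ≤ ρ)
    (hm : u x + u y - ρ ≤ 2 * u ((1 / 2 : ℝ) • x + (1 / 2 : ℝ) • y))
    {a b : ℝ} (ha : 0 ≤ a) (hb : 0 ≤ b) (hab : a + b = 1) :
    a * u x + b * u y - ρ ≤ u (a • x + b • y) := by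
  -- With `b ≤ a` the midpoint lies between `a • x + b • y` and `y`; convexity there is solved for
  -- the value at `a • x + b • y`.
  wlog hle : b ≤ a generalizing x y a b
  · have := this hy hx (by rwa [add_comm (u y), add_comm (_ • y)]) hb ha (by rwa [add_comm])
      (le_of_not_ge hle)
    rwa [add_comm (b * u y), add_comm (b • y)] at this
  have hz : a • x + b • y ∈ C := hu.1 hx hy ha hb hab
  have ha' : 0 < a := by linarith
  have h := hu.2 hz hy (by positivity : 0 ≤ 1 / (2 * a))
    (div_nonneg (by linarith) (by linarith) : 0 ≤ (2 * a - 1) / (2 * a)) (by field_simp; ring)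
  have hcomb : (1 / (2 * a)) • (a • x + b • y) + ((2 * a - 1) / (2 * a)) • y
      = (1 / 2 : ℝ) • x + (1 / 2 : ℝ) • y := by
    obtain rfl : b = 1 - a := by linarith
    match_scalars <;> field_simp
    ring
  rw [hcomb, smul_eq_mul, smul_eq_mul] at h
  have h1 := mul_le_mul_of_nonneg_left h (by positivity : 0 ≤ 2 * a)
  have h2 : 2 * a * (1 / (2 * a) * u (a • x + b • y) + (2 * a - 1) / (2 * a) * u y)
      = u (a • x + b • y) + (2 * a - 1) * u y := by
    field_simp
  have h3 := mul_le_mul_of_nonneg_left hm ha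
  have h4 : a * ρ ≤ ρ := mul_le_of_le_one_left hρ (by linarith)
  obtain rfl : b = 1 - a := by linarith
  linarith

/-- The regularisation `x ↦ inf_y f y + N (h x + h y - 2 h ((x + y) / 2))` of a bounded function
`f` is a difference of convex Lipschitz functions, and it is close to `f` if the midpoint
convexity defect of `h` controls the oscillation of `f`. -/
lemma exists_isDCLipschitzOn_of_midpoint {C : Set X} (hne : C.Nonempty) {f h : X → ℝ}
    {B B' r δ : ℝ} {K : ℝ≥0} (hf : ∀ x ∈ C, |f x| ≤ B) (hh : ConvexOn ℝ C h)
    (hhK : LipschitzOnWith K h C) (hhB : ∀ x ∈ C, |h x| ≤ B') (hr : 0 ≤ r) (hδ : 0 < δ)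
    (H : ∀ x ∈ C, ∀ y ∈ C, h x + h y - 2 * h ((1 / 2 : ℝ) • x + (1 / 2 : ℝ) • y) < δ →
      |f x - f y| ≤ r) :
    ∃ g, IsDCLipschitzOn C g ∧ ∀ x ∈ C, |f x - g x| ≤ r := by
  -- Once the defect reaches `δ`, the penalty exceeds any possible oscillation of `f`.
  obtain ⟨N, hN⟩ : ∃ N : ℕ, 2 * B ≤ N * δ := by
    obtain ⟨N, hN⟩ := exists_nat_ge (2 * B / δ)
    exact ⟨N, (div_le_iff₀ hδ).1 hN⟩
  have hmid : ∀ x ∈ C, ∀ y ∈ C, (1 / 2 : ℝ) • x + (1 / 2 : ℝ) • y ∈ C := fun x hx y hy =>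
    hh.1 hx hy (by norm_num) (by norm_num) (by norm_num)
  let t : X → X → ℝ := fun y x => 2 * N * h ((1 / 2 : ℝ) • x + (1 / 2 : ℝ) • y) - N * h y - f y
  let v : X → ℝ := fun x => ⨆ y : C, t y x
  have : Nonempty C := hne.to_subtype
  have hbd : ∀ x ∈ C, BddAbove (Set.range fun y : C => t y x) := by
    rintro x hx
    refine ⟨2 * N * B' + N * B' + B, ?_⟩
    rintro _ ⟨⟨y, hy⟩, rfl⟩
    have h1 := mul_le_mul_of_nonneg_left (abs_le.1 (hhB _ (hmid x hx y hy))).2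
      (by positivity : (0 : ℝ) ≤ 2 * N)
    have h2 := mul_le_mul_of_nonneg_left (abs_le.1 (hhB y hy)).1 (by positivity : (0 : ℝ) ≤ N)
    have h3 := (abs_le.1 (hf y hy)).1
    simp only [t]
    linarith
  have hle : ∀ x ∈ C, ∀ y ∈ C, t y x ≤ v x := fun x hx y hy => le_ciSup (hbd x hx) ⟨y, hy⟩
  have hv : ConvexOn ℝ C v := by
    refine ⟨hh.1, fun x hx x' hx' a b ha hb hab => ciSup_le ?_⟩
    rintro ⟨y, hy⟩
    have h1 := hh.2 (hmid x hx y hy) (hmid x' hx' y hy) ha hb hab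
    have h2 : a • ((1 / 2 : ℝ) • x + (1 / 2 : ℝ) • y) + b • ((1 / 2 : ℝ) • x' + (1 / 2 : ℝ) • y)
        = (1 / 2 : ℝ) • (a • x + b • x') + (1 / 2 : ℝ) • y := by
      rw [← eq_sub_iff_add_eq'] at hab
      subst hab
      module
    rw [h2] at h1
    have h3 := mul_le_mul_of_nonneg_left h1 (by positivity : (0 : ℝ) ≤ 2 * N)
    have h4 := mul_le_mul_of_nonneg_left (hle x hx y hy) ha
    have h5 := mul_le_mul_of_nonneg_left (hle x' hx' y hy) hb
    simp only [smul_eq_mul, t] at *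
    rw [← eq_sub_iff_add_eq'] at hab
    subst hab
    linarith
  have hvL : LipschitzOnWith (2 * N * K) v C := by
    refine LipschitzOnWith.of_le_add_mul _ fun x hx x' hx' => ciSup_le ?_
    rintro ⟨y, hy⟩
    have h1 := (abs_le.1 (hhK.dist_le_mul _ (hmid x hx y hy) _ (hmid x' hx' y hy))).2
    have h2 : dist ((1 / 2 : ℝ) • x + (1 / 2 : ℝ) • y) ((1 / 2 : ℝ) • x' + (1 / 2 : ℝ) • y)
        ≤ dist x x' := by
      rw [dist_add_right, dist_smul₀, Real.norm_of_nonneg (by norm_num)]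
      linarith [dist_nonneg (x := x) (y := x')]
    have h3 := h1.trans (mul_le_mul_of_nonneg_left h2 K.2)
    have h4 := mul_le_mul_of_nonneg_left h3 (by positivity : (0 : ℝ) ≤ 2 * N)
    have h5 := hle x' hx' y hy
    push_cast
    simp only [t] at *
    linarith
  refine ⟨fun x => N * h x - v x, ⟨fun x => N * h x, v, hh.smul N.cast_nonneg, hv,
    ⟨N * K, LipschitzOnWith.of_le_add_mul _ fun x hx x' hx' => ?_⟩, ⟨_, hvL⟩, fun _ _ => rfl⟩,
    fun x hx => abs_le.2 ⟨?_, ?_⟩⟩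
  · have h1 := (abs_le.1 (hhK.dist_le_mul _ hx _ hx')).2
    have h4 := mul_le_mul_of_nonneg_left h1 (by positivity : (0 : ℝ) ≤ N)
    push_cast
    linarith
  -- Taking `y = x`, where the defect vanishes, gives `g ≤ f`.
  · have h1 := hle x hx x hx
    have h2 : (1 / 2 : ℝ) • x + (1 / 2 : ℝ) • x = x := by module
    simp only [t, h2] at h1
    linarith
  · have h1 : v x ≤ N * h x - f x + r := by
      refine ciSup_le ?_
      rintro ⟨y, hy⟩
      have h2 := hh.midpoint_le hx hy
      have h3 : f x - f y - r ≤
          N * (h x + h y - 2 * h ((1 / 2 : ℝ) • x + (1 / 2 : ℝ) • y)) := by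
        rcases lt_or_ge (h x + h y - 2 * h ((1 / 2 : ℝ) • x + (1 / 2 : ℝ) • y)) δ with hlt | hge
        · have := (abs_le.1 (H x hx y hy hlt)).2
          have : 0 ≤ N * (h x + h y - 2 * h ((1 / 2 : ℝ) • x + (1 / 2 : ℝ) • y)) :=
            mul_nonneg N.cast_nonneg (by linarith)
          linarith
        · have := mul_le_mul_of_nonneg_left hge (by positivity : (0 : ℝ) ≤ N)
          linarith [(abs_le.1 (hf x hx)).2, (abs_le.1 (hf y hy)).1]
      simp only [t]
      linarith
    linarith

end Approximation

/-! ### From finite index to DC approximation. -/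

section Oscillation

variable {X : Type*} [NormedAddCommGroup X] [NormedSpace ℝ X]

/-- If the distances to all the iterated derived sets are nearly equal at `x` and `y` and nearly
midpoint affine, then `f x` and `f y` differ by little more than `2 * ε`. -/
lemma abs_sub_le_of_infDist_dentIter {C : Set X} (hC : Convex ℝ C) {f : X → ℝ} {ε τ ρ : ℝ}
    (hε : 0 ≤ ε) (hρ : 0 < ρ) {n : ℕ} (hne : ∀ k < n, (dentIter f ε C k).Nonempty)
    (hn : dentIter f ε C n = ∅)
    (hf : ∀ x ∈ C, ∀ y ∈ C, dist x y < 6 * n * ρ → |f x - f y| ≤ τ) {x y : X} (hx : x ∈ C)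
    (hy : y ∈ C)
    (hxy : ∀ k < n, |Metric.infDist x (dentIter f ε C k) -
      Metric.infDist y (dentIter f ε C k)| ≤ ρ)
    (hm : ∀ k < n, Metric.infDist x (dentIter f ε C k) + Metric.infDist y (dentIter f ε C k) - ρ ≤
      2 * Metric.infDist ((1 / 2 : ℝ) • x + (1 / 2 : ℝ) • y) (dentIter f ε C k)) :
    |f x - f y| ≤ 2 * ε + 2 * τ := by
  have hn0 : 0 < n := by
    rcases n.eq_zero_or_pos with rfl | h
    · exact absurd hx (by rw [show C = ∅ from hn]; exact Set.notMem_empty x)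
    · exact h
  -- The last level before the distance from `x` first outgrows `6 * k * ρ`. The gap `6 * ρ` absorbs
  -- the errors in the distances and in the choice of `x'`, `y'`.
  obtain ⟨k, hk, hk1, hk2⟩ : ∃ k < n, Metric.infDist x (dentIter f ε C k) ≤ 6 * k * ρ ∧
      (k + 1 < n → 6 * (k + 1) * ρ < Metric.infDist x (dentIter f ε C (k + 1))) := by
    by_contra! hcon
    have hall : ∀ k < n, Metric.infDist x (dentIter f ε C k) ≤ 6 * k * ρ := by
      intro k
      induction k with
      | zero => simp [Metric.infDist_zero_of_mem, dentIter, hx]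
      | succ k ih =>
        intro hk
        have := (hcon k (by omega) (ih (by omega))).2
        exact_mod_cast this
    have h1 := (hcon (n - 1) (by omega) (hall _ (by omega))).1
    omega
  have hkn : (k : ℝ) + 1 ≤ n := by exact_mod_cast hk
  have hkρ : 6 * k * ρ + 6 * ρ ≤ 6 * n * ρ := by nlinarith
  have hyk : Metric.infDist y (dentIter f ε C k) ≤ 6 * k * ρ + ρ := by
    linarith [(abs_le.1 (hxy k hk)).1]
  obtain ⟨x', hx', hxx'⟩ := (Metric.infDist_lt_iff (hne k hk)).1
    (show Metric.infDist x (dentIter f ε C k) < 6 * k * ρ + 2 * ρ by linarith)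
  obtain ⟨y', hy', hyy'⟩ := (Metric.infDist_lt_iff (hne k hk)).1
    (show Metric.infDist y (dentIter f ε C k) < 6 * k * ρ + 2 * ρ by linarith)
  have hdisj : Disjoint (segment ℝ x' y') (dentDeriv f ε (dentIter f ε C k)) := by
    refine Set.disjoint_left.2 ?_
    rintro _ ⟨a, b, ha, hb, hab, rfl⟩ hz
    change _ ∈ dentIter f ε C (k + 1) at hz
    -- The last derived set is empty and `Metric.infDist` to it is the default 0, so this case must
    -- be excluded before distances are used.
    have hk' : k + 1 < n := by
      refine lt_of_le_of_ne hk fun h => ?_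
      rw [h, hn] at hz
      exact hz
    have h1 : dist (a • x + b • y) (a • x' + b • y') ≤ a * dist x x' + b * dist y y' := by
      refine (dist_add_add_le _ _ _ _).trans_eq ?_
      rw [dist_smul₀, dist_smul₀, Real.norm_of_nonneg ha, Real.norm_of_nonneg hb]
    have h2 := Metric.infDist_le_dist_of_mem (x := a • x + b • y) hz
    have h3 := ((hC.dentIter (k + 1)).convexOn_infDist hC).le_of_midpoint hx hy hρ.le
      (hm _ hk') ha hb hab
    have h4 := (abs_le.1 (hxy _ hk')).2
    have h5 := hk2 hk'
    have h6 := mul_le_mul_of_nonneg_left hxx'.le ha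
    have h7 := mul_le_mul_of_nonneg_left hyy'.le hb
    have h8 := mul_le_mul_of_nonneg_left h4 hb
    have h9 : b * ρ ≤ ρ := mul_le_of_le_one_left hρ.le (by linarith)
    obtain rfl : a = 1 - b := by linarith
    linarith
  have h1 := abs_sub_le_of_disjoint_dentDeriv hε (hC.dentIter k) hx' hy' hdisj
  have h2 := hf x hx x' (dentIter_subset C k hx') (by linarith)
  have h3 := hf y' (dentIter_subset C k hy') y hy (by rw [dist_comm]; linarith)
  linarith [abs_sub_le (f x) (f x') (f y), abs_sub_le (f x') (f y') (f y)]

lemma exists_isDCLipschitzOn_of_Dz_lt_top {C : Set X} (hbdd : Bornology.IsBounded C)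
    (hconv : Convex ℝ C) {f : X → ℝ} (hf : UniformContinuousOn f C) {ε τ : ℝ} (hε : 0 ≤ ε)
    (hτ : 0 < τ) (hDz : Dz C f ε < ⊤) :
    ∃ g, IsDCLipschitzOn C g ∧ ∀ x ∈ C, |f x - g x| ≤ 2 * ε + 2 * τ := by
  classical
  rcases C.eq_empty_or_nonempty with rfl | hCne
  · exact ⟨0, ⟨0, 0, convexOn_const 0 convex_empty, convexOn_const 0 convex_empty, ⟨0, by simp⟩,
      ⟨0, by simp⟩, by simp⟩, by simp⟩
  have hex := Dz_lt_top_iff.1 hDz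
  let n := Nat.find hex
  have hn : dentIter f ε C n = ∅ := Nat.find_spec hex
  have hne : ∀ k < n, (dentIter f ε C k).Nonempty := fun k hk =>
    Set.nonempty_iff_ne_empty.2 (Nat.find_min hex hk)
  obtain ⟨B, hB⟩ := hf.exists_abs_le_of_isBounded_of_convex hbdd hconv
  obtain ⟨η, hη, hfη⟩ := Metric.uniformContinuousOn_iff.1 hf τ hτ
  let ρ := η / (6 * n + 1)
  have hρ : 0 < ρ := by positivity
  have hρη : 6 * n * ρ ≤ η := by
    have h : (6 * n + 1) * ρ = η := by simp only [ρ]; field_simp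
    linarith
  let d : ℕ → X → ℝ := fun k x => Metric.infDist x (dentIter f ε C k)
  have hd0 : ∀ k x, 0 ≤ d k x := fun k x => Metric.infDist_nonneg
  have hd : ∀ k, ConvexOn ℝ C (d k) := fun k => (hconv.dentIter k).convexOn_infDist hconv
  have hd2 : ∀ k, ConvexOn ℝ C fun x => d k x ^ 2 := fun k => (hd k).pow (fun x _ => hd0 k x) 2
  have hdL : ∀ k, LipschitzOnWith 1 (d k) C := fun k =>
    (Metric.lipschitz_infDist_pt _).lipschitzOnWith
  -- Defects of `d k` control affinity along the segment; those of `d k ^ 2` control `|d k x - d k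
  -- y|`.
  let h : X → ℝ := fun x => ∑ k ∈ Finset.range n, (d k x + d k x ^ 2)
  obtain ⟨K, hK⟩ : ∃ K, LipschitzOnWith K h C := by
    refine LipschitzOnWith.exists_sum _ fun k _ => ?_
    obtain ⟨M, hM⟩ :=
      (hdL k).uniformContinuousOn.exists_abs_le_of_isBounded_of_convex hbdd hconv
    obtain ⟨L, hL⟩ := (hdL k).exists_sq hM
    exact ⟨1 + L, (hdL k).add hL⟩
  obtain ⟨B', hB'⟩ := hK.uniformContinuousOn.exists_abs_le_of_isBounded_of_convex hbdd hconv
  have hh : ConvexOn ℝ C h := ConvexOn.finset_sum hconv _ fun k _ => (hd k).add (hd2 k)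
  refine exists_isDCLipschitzOn_of_midpoint hCne hB hh hK hB' (by positivity)
    (lt_min hρ (by positivity : 0 < ρ ^ 2 / 2)) fun x hx y hy hxy => ?_
  let m := (1 / 2 : ℝ) • x + (1 / 2 : ℝ) • y
  have hterm : ∀ k < n, (d k x + d k y - 2 * d k m) + (d k x ^ 2 + d k y ^ 2 - 2 * d k m ^ 2) ≤
      h x + h y - 2 * h m := by
    intro k hk
    have heq : h x + h y - 2 * h m = ∑ k ∈ Finset.range n,
        ((d k x + d k y - 2 * d k m) + (d k x ^ 2 + d k y ^ 2 - 2 * d k m ^ 2)) := by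
      simp only [h, Finset.mul_sum, ← Finset.sum_add_distrib, ← Finset.sum_sub_distrib]
      exact Finset.sum_congr rfl fun _ _ => by ring
    rw [heq]
    refine Finset.single_le_sum (f := fun k => (d k x + d k y - 2 * d k m) +
      (d k x ^ 2 + d k y ^ 2 - 2 * d k m ^ 2)) (fun j _ => ?_) (Finset.mem_range.2 hk)
    linarith [(hd j).midpoint_le hx hy, (hd2 j).midpoint_le hx hy]
  have hlt1 := hxy.trans_le (min_le_left _ _)
  have hlt2 := hxy.trans_le (min_le_right _ _)
  refine abs_sub_le_of_infDist_dentIter hconv hε hρ hne hn (fun x hx y hy hxy => ?_) hx hy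
    (fun k hk => ?_) fun k hk => ?_
  · have := hfη x hx y hy (hxy.trans_le hρη)
    rw [Real.dist_eq] at this
    exact this.le
  · have h1 := (hd k).midpoint_le hx hy
    have h2 := hterm k hk
    -- Uses `p ^ 2 + q ^ 2 - 2 * ((p + q) / 2) ^ 2 = (p - q) ^ 2 / 2`, the source of the threshold
    -- `ρ ^ 2 / 2`.
    have h3 : d k m ^ 2 ≤ ((d k x + d k y) / 2) ^ 2 :=
      pow_le_pow_left₀ (hd0 k m) (by linarith) 2
    refine abs_le_of_sq_le_sq ?_ hρ.le
    change (d k x - d k y) ^ 2 ≤ ρ ^ 2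
    have h4 : h x + h y - 2 * h m < ρ ^ 2 / 2 := hlt2
    have h5 : 2 * d k m ≤ d k x + d k y := h1
    nlinarith
  · have h1 := (hd2 k).midpoint_le hx hy
    have h2 := hterm k hk
    have h4 : h x + h y - 2 * h m < ρ := hlt1
    have h5 : 2 * d k m ^ 2 ≤ d k x ^ 2 + d k y ^ 2 := h1
    change d k x + d k y - ρ ≤ 2 * d k m
    linarith

end Oscillation

/-! ### Comparison of the two infima. -/

lemma supNormOn_le_ofReal_iff {X : Type*} {C : Set X} {h : X → ℝ} {r : ℝ} (hr : 0 ≤ r) :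
    supNormOn C h ≤ ENNReal.ofReal r ↔ ∀ x ∈ C, |h x| ≤ r := by
  simp only [supNormOn, iSup₂_le_iff]
  refine forall₂_congr fun x _ => ?_
  rw [Real.enorm_eq_ofReal_abs, ENNReal.ofReal_le_ofReal_iff hr]

theorem theorem5p7 {X : Type*} [NormedAddCommGroup X] [NormedSpace ℝ X] [CompleteSpace X]
    [Nontrivial X] (C : Set X) (hbdd : Bornology.IsBounded C) (hclosed : IsClosed C)
    (hconv : Convex ℝ C) (f : X → ℝ) (hf : UniformContinuousOn f C) :
    (dentableEps C f).Nonempty ∧ (dcApproxEps C f).Nonempty ∧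
      sInf (dentableEps C f) / 2 ≤ sInf (dcApproxEps C f) ∧
      sInf (dcApproxEps C f) ≤ 2 * sInf (dentableEps C f) := by
  have hdent : ∀ e ∈ dcApproxEps C f, ∀ τ > 0, 2 * e + τ ∈ dentableEps C f := by
    rintro e ⟨he, g, hg, hfg⟩ τ hτ
    exact ⟨by positivity, Dz_lt_top_of_close_isDCLipschitzOn hbdd hclosed hconv he.le hτ hg
      ((supNormOn_le_ofReal_iff he.le).1 hfg.le)⟩
  have hdc : ∀ r ≥ 0, (∃ g, IsDCLipschitzOn C g ∧ ∀ x ∈ C, |f x - g x| ≤ r) → ∀ τ > 0,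
      r + τ ∈ dcApproxEps C f := by
    rintro r hr ⟨g, hg, hfg⟩ τ hτ
    exact ⟨by positivity, g, hg, ((supNormOn_le_ofReal_iff hr).2 hfg).trans_lt
      ((ENNReal.ofReal_lt_ofReal_iff (by positivity)).2 (by linarith))⟩
  obtain ⟨M, hM⟩ := hf.exists_abs_le_of_isBounded_of_convex hbdd hconv
  have hne2 : (dcApproxEps C f).Nonempty :=
    ⟨_, hdc |M| (abs_nonneg M) ⟨0, ⟨0, 0, convexOn_const 0 hconv, convexOn_const 0 hconv,
      ⟨0, (LipschitzWith.const 0).lipschitzOnWith⟩, ⟨0, (LipschitzWith.const 0).lipschitzOnWith⟩,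
      by simp⟩, fun x hx => by simpa using (hM x hx).trans (le_abs_self M)⟩ 1 one_pos⟩
  have hne1 : (dentableEps C f).Nonempty :=
    let ⟨e, he⟩ := hne2
    ⟨_, hdent e he 1 one_pos⟩
  have hb1 : BddBelow (dentableEps C f) := ⟨0, fun e he => he.1.le⟩
  have hb2 : BddBelow (dcApproxEps C f) := ⟨0, fun e he => he.1.le⟩
  refine ⟨hne1, hne2, le_csInf hne2 fun e he => ?_, ?_⟩
  · have := le_of_forall_pos_le_add fun τ hτ => csInf_le hb1 (hdent e he τ hτ)
    linarith
  · suffices sInf (dcApproxEps C f) / 2 ≤ sInf (dentableEps C f) by linarith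
    refine le_csInf hne1 fun e he => ?_
    have : sInf (dcApproxEps C f) ≤ 2 * e := by
      refine le_of_forall_pos_le_add fun τ hτ => ?_
      have h1 := hdc _ (by linarith [he.1]) (exists_isDCLipschitzOn_of_Dz_lt_top hbdd hconv hf
        he.1.le (by positivity : 0 < τ / 4) he.2) (τ / 2) (by positivity)
      exact (csInf_le hb2 h1).trans (by linarith)
    linarith
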